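/- Let $n\ge 1$, and consider $n$ players who all have the same finite non-empty set $S_1$ of pure strategies. Let $\Delta_1=\{y\in\mathbb{R}^{S_1} : y_\alpha\ge 0,\ \sum_\alpha y_\alpha=1\}$ and $\Delta=\Delta_1^n\subseteq(\mathbb{R}^{S_1})^n$; write $x=(x_{i\alpha})$ for the points of $(\mathbb{R}^{S_1})^n$. Let $\sigma_1,\dots,\sigma_n$ be permutations of $S_1$ and $$U=\{x\in\Delta : x_{1\sigma_i(\alpha)}=x_{i\alpha}\ \text{ for all } i \text{ and } \alpha\in S_1\}.$$ Let $D$ be a set with $\Delta\subseteq D\subseteq(\mathbb{R}^{S_1})^n$ (for example $D=\Delta$ or $D=(\mathbb{R}^{S_1})^n$) and let $\varphi:D\to(\mathbb{R}^{S_1})^n$ be a continuous incentive function, that is, a continuous function such that for all $x\in D$ and all players $i$: $x_{i\alpha}=0$ implies $\varphi_{i\alpha}(x)\ge 0$ for every $\alpha$, and $\sum_\beta\varphi_{i\beta}(x)\neq-1$. Suppose that $\varphi_{1\sigma_i(\alpha)}(x)=\varphi_{i\alpha}(x)$ for all $x\in U$, all $i$ and all $\alpha$. Then an incentive equilibrium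 exists in $U$: there is an $\hat x\in U$ that is a fixed point of the updating protocol $$T(x)_{i\alpha}=\frac{x_{i\alpha}+\varphi_{i\alpha}(x)}{1+\sum_\beta\varphi_{i\beta}(x)},$$ i.e. $T(\hat x)=\hat x$. Moreover, this $\hat x$ satisfies $$\hat x_i\cdot\frac{\varphi_i(\hat x)}{\hat x_i}=\max_{y\in\Delta_1}\ y\cdot\frac{\varphi_i(\hat x)}{\hat x_i}$$ for every player $i$ for whom $\sum_\beta\varphi_{i\beta}(\hat x)\ge 0$ or all coordinates of $\hat x_i$ are nonzero. Here $\varphi_i(\hat x)/\hat x_i$ is the vector with entries $\varphi_{i\alpha}(\hat x)/\hat x_{i\alpha}$, with the convention that an entry is $0$ if $\varphi_{i\alpha}(\hat x)=0$; in the situation of the displayed equation, $\hat x_{i\alpha}=0$ implies $\varphi_{i\alpha}(\hat x)=0$, so that all entries are defined. -/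

import Mathlib

namespace IncentiveGame

/-- The space of mixed strategy profiles `Δ = ×ᵢ Δᵢ` of a finite game whose player `i` has the
finite set of pure strategies `S i`, inside `×ᵢ ℝ^{S i}`. -/
def profiles {ι : Type*} (S : ι → Type*) [∀ i, Fintype (S i)] : Set ((i : ι) → S i → ℝ) :=
  {x | ∀ i, x i ∈ stdSimplex ℝ (S i)}

/-- `φ` is an incentive function on the set `D ⊆ ×ᵢ ℝ^{S i}`: at every point of `D`,
a strategy which is not played has nonnegative incentive, and no player has total
incentive `-1`. -/
structure IsIncentiveOn {ι : Type*} {S : ι → Type*} [∀ i, Fintype (S i)]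
    (D : Set ((i : ι) → S i → ℝ)) (φ : ((i : ι) → S i → ℝ) → ((i : ι) → S i → ℝ)) : Prop where
  nonneg_of_eq_zero : ∀ x ∈ D, ∀ i α, x i α = 0 → 0 ≤ φ x i α
  sum_ne_neg_one : ∀ x ∈ D, ∀ i, ∑ β, φ x i β ≠ -1

/-- The updating protocol
`T(x)ᵢ = (xᵢ + ∑_α φ_{iα}(x) e_{iα}) / (1 + ∑_β φ_{iβ}(x))`, written in coordinates. -/
noncomputable def update {ι : Type*} {S : ι → Type*} [∀ i, Fintype (S i)]
    (φ : ((i : ι) → S i → ℝ) → ((i : ι) → S i → ℝ)) (x : (i : ι) → S i → ℝ) :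
    (i : ι) → S i → ℝ :=
  fun i α => (x i α + φ x i α) / (1 + ∑ β, φ x i β)

/-- The equilibrium equation of player `i` at the profile `x`:
`xᵢ · (φᵢ(x)/xᵢ) = max_{y ∈ Δᵢ} y · (φᵢ(x)/xᵢ)`. The quotient `φ_{iα}(x)/x_{iα}` is `0` when
`φ_{iα}(x) = 0`, also if `x_{iα} = 0`; the first conjunct says that it is never of the undefined
form `c/0` with `c ≠ 0`. -/
def EquilibriumEquation {ι : Type*} {S : ι → Type*} [∀ i, Fintype (S i)]
    (φ : ((i : ι) → S i → ℝ) → ((i : ι) → S i → ℝ)) (x : (i : ι) → S i → ℝ) (i : ι) : Prop :=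
  (∀ α, x i α = 0 → φ x i α = 0) ∧
    IsGreatest ((fun y : S i → ℝ => ∑ α, y α * (φ x i α / x i α)) '' stdSimplex ℝ (S i))
      (∑ α, x i α * (φ x i α / x i α))

/-- The profiles `x ∈ Δ` with `x_{1 σᵢ(α)} = x_{i α}` for all players `i` and all strategies `α`,
when all players have the pure strategy set `S₁`. The first player is `0 : Fin n`. -/
def symmetricProfiles {n : ℕ} [NeZero n] {S₁ : Type*} [Fintype S₁]
    (σ : Fin n → Equiv.Perm S₁) : Set (Fin n → S₁ → ℝ) :=
  {x | x ∈ profiles (fun _ : Fin n => S₁) ∧ ∀ i α, x 0 (σ i α) = x i α}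

end IncentiveGame

/-!
A profile `x` is a fixed point of the updating protocol exactly when `φᵢ(x) = (∑_β φ_{iβ}(x)) xᵢ` for
every player `i`. In a symmetric profile, the strategy `y` of the first player, which is invariant
under `σ 0`, determines those of the others, and by the symmetry of `φ` the equation of the first
player implies the other ones. Hence it is enough to find an invariant `y` in the simplex at which
the vector field `v = ψ - (∑ ψ) y` vanishes, where `ψ(y)` is the incentive of the first player. This
field is tangent to the simplex and points inwards at its boundary. The map
`y ↦ (y + v⁺) / (1 + ∑ v⁺)` preserves the simplex, and its fixed points are zeros of `v`; composing
it with the average over the powers of `σ 0` forces the fixed point to be invariant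
(`exists_invariant_proportional`). At such a point every quotient `φ_{iα} / x_{iα}` with
`x_{iα} ≠ 0` is the same number, from which the equilibrium equation follows
(`equilibriumEquation_of_proportional`).

The fixed point comes from Brouwer's theorem for the simplex (`exists_fixedPoint_stdSimplex`),
proved here by Scarf's argument, which replaces triangulations by linear orders. Given finitely many
points, ordered by each of their coordinates, together with one slack element per coordinate, call a
set dominant if each element lies below the whole set in some order. A dominant set of one
element less than full size has two dominant extensions (`Scarf.Dominant.card_insert_eq_two`), except
that the set of all slack elements but one has a unique one (`Scarf.card_insert_slack_eq_one`). With
this in place of the incidences in a triangulated simplex, Sperner's parity argument yields a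
dominant set carrying all colors (`Scarf.exists_dominant_image_eq_univ`). For a fine net, the points
of a dominant set are close together.
-/

/-! ### Scarf's combinatorial lemma -/

namespace Scarf

variable {ι X L : Type*} [Fintype ι] [DecidableEq ι] [Fintype X] [DecidableEq X] [LinearOrder L]

/-- `A` is dominant for the orders on `X` given by the functions `u i` if every `y : X` lies below
all of `A` in at least one of these orders. -/
def Dominant (u : ι → X → L) (A : Finset X) : Prop :=
  ∀ y, ∃ i, ∀ a ∈ A, u i y ≤ u i a

omit [Fintype ι] [DecidableEq ι] [Fintype X] [DecidableEq X] in
theorem Dominant.mono {u : ι → X → L} {A B : Finset X} (hA : Dominant u A) (h : B ⊆ A) :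
    Dominant u B := fun y => by
  obtain ⟨i, hi⟩ := hA y
  exact ⟨i, fun a ha => hi a (h ha)⟩

/-- Pivoting: a dominant set `B` with one element fewer than `ι` extends by one element to a dominant
set in exactly two ways. The map sending `i` to the `u i`-minimum of `B` is onto `B`, hence takes
one value twice, at `i` and `j` say. For each `k ∈ {i, j}` the new element is the `u k`-largest one
among those beating the `u l`-minimum of `B` for all `l ≠ k`; `hext` provides candidates. -/
theorem Dominant.card_insert_eq_two {u : ι → X → L} (hu : ∀ i, Function.Injective (u i))
    {B : Finset X} (hB : Dominant u B) (hne : B.Nonempty) (hcard : B.card + 1 = Fintype.card ι)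
    (hext : ∀ k, ∃ y, ∀ l, l ≠ k → ∃ b ∈ B, u l b < u l y)
    (P : X → Prop) [DecidablePred P] (hP : ∀ x, P x ↔ x ∉ B ∧ Dominant u (insert x B)) :
    (Finset.univ.filter P).card = 2 := by
  classical
  -- `m i` is the `u i`-minimum of `B`
  choose m hmB hm using fun i => B.exists_min_image (u i) hne
  have hsurj : ∀ b ∈ B, ∃ l, m l = b := fun b hb => by
    obtain ⟨l, hl⟩ := hB b
    exact ⟨l, hu l (le_antisymm (hm l b hb) (hl _ (hmB l)))⟩
  obtain ⟨i, -, j, -, hij, hmij⟩ := Finset.exists_ne_map_eq_of_card_lt_of_maps_to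
    (s := Finset.univ) (t := B) (f := m) (by rw [Finset.card_univ]; omega) (fun i _ => hmB i)
  have hnot : ∀ y, ¬ ∀ l, u l (m l) < u l y := fun y hy => by
    obtain ⟨l, hl⟩ := hB y
    exact (hy l).not_ge (hl _ (hmB l))
  have hmax : ∀ k, ∃ x, (∀ l, l ≠ k → u l (m l) < u l x) ∧
      ∀ y, (∀ l, l ≠ k → u l (m l) < u l y) → u k y ≤ u k x := fun k => by
    obtain ⟨y, hy⟩ := hext k
    obtain ⟨x, hx, hx'⟩ := Finset.exists_max_image
      (Finset.univ.filter fun y => ∀ l, l ≠ k → u l (m l) < u l y)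
      (u k) ⟨y, by
        simp only [Finset.mem_filter, Finset.mem_univ, true_and]
        intro l hl
        obtain ⟨b, hb, hlt⟩ := hy l hl
        exact (hm l b hb).trans_lt hlt⟩
    exact ⟨x, by simpa using hx, fun y hy => hx' y (by simpa using hy)⟩
  -- `g k` is the candidate for taking over as the minimum in the order `k`
  choose g hg hgmax using hmax
  -- for `k ∈ {i, j}` every element of `B` is still a minimum `m l` for some `l ≠ k`
  have hgP : ∀ k k', k ≠ k' → m k = m k' → P (g k) := fun k k' hk hmk => by
    refine (hP _).2 ⟨fun hmem => ?_, fun y => ?_⟩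
    · obtain ⟨l, hl⟩ := hsurj _ hmem
      by_cases h : l = k
      · subst h
        have := hg l k' hk.symm
        rw [← hmk, hl] at this
        exact lt_irrefl _ this
      · have := hg k l h
        rw [hl] at this
        exact lt_irrefl _ this
    · by_contra! hcon
      have hy : ∀ l, l ≠ k → u l (m l) < u l y := fun l hl => by
        obtain ⟨a, ha, hlt⟩ := hcon l
        rcases Finset.mem_insert.1 ha with rfl | ha
        · exact (hg k l hl).trans hlt
        · exact (hm l a ha).trans_lt hlt
      obtain ⟨a, ha, hlt⟩ := hcon k
      rcases Finset.mem_insert.1 ha with rfl | haB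
      · exact hlt.not_ge (hgmax k y hy)
      · refine hnot y fun l => ?_
        by_cases h : l = k
        · subst h; exact (hm l a haB).trans_lt hlt
        · exact hy l h
  have hPg : ∀ x, P x → x = g i ∨ x = g j := fun x hx => by
    obtain ⟨hxB, hdom⟩ := (hP x).1 hx
    obtain ⟨k, hk⟩ := hdom x
    -- each `b ∈ B` stays minimal in some order after adding `x`; `x` is minimal in the order `k`,
    -- so by counting these orders exhaust all `l ≠ k`
    have hs : ∀ b : B, ∃ l, m l = b ∧ u l b < u l x := fun b => by
      obtain ⟨l, hl⟩ := hdom b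
      refine ⟨l, hu l (le_antisymm (hm l b b.2) (hl _ (Finset.mem_insert_of_mem (hmB l)))), ?_⟩
      refine lt_of_le_of_ne (hl x (Finset.mem_insert_self _ _)) fun h => hxB ?_
      rw [← hu l h]; exact b.2
    choose s hsm hsx using hs
    have hsinj : Function.Injective s := fun a b h => Subtype.ext (by rw [← hsm a, ← hsm b, h])
    have hsimg : Finset.univ.image s = Finset.univ.erase k := by
      refine Finset.eq_of_subset_of_card_le (fun l hl => ?_) ?_
      · obtain ⟨b, -, rfl⟩ := Finset.mem_image.1 hl
        refine Finset.mem_erase.2 ⟨?_, Finset.mem_univ _⟩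
        rintro rfl
        exact (hsx b).not_ge (hk b (Finset.mem_insert_of_mem b.2))
      · rw [Finset.card_image_of_injective _ hsinj, Finset.card_erase_of_mem (Finset.mem_univ _),
          Finset.card_univ, Finset.card_univ, Fintype.card_coe]
        omega
    have hsof : ∀ l, l ≠ k → ∃ b, s b = l := fun l hl => by
      have : l ∈ Finset.univ.image s := by rw [hsimg]; simpa using hl
      simpa using this
    have hxM : ∀ l, l ≠ k → u l (m l) < u l x := fun l hl => by
      obtain ⟨b, rfl⟩ := hsof l hl
      rw [hsm]; exact hsx b
    have hxmax : ∀ y, (∀ l, l ≠ k → u l (m l) < u l y) → u k y ≤ u k x := fun y hy => by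
      obtain ⟨l, hl⟩ := hdom y
      by_cases h : l = k
      · subst h; exact hl x (Finset.mem_insert_self _ _)
      · exact absurd (hl _ (Finset.mem_insert_of_mem (hmB l))) (hy l h).not_ge
    have hxg : x = g k := hu k (le_antisymm (hgmax k x hxM) (hxmax _ (hg k)))
    have hk' : k = i ∨ k = j := by
      by_contra! hcon
      obtain ⟨a, ha⟩ := hsof i hcon.1.symm
      obtain ⟨b, hb⟩ := hsof j hcon.2.symm
      apply hij
      rw [← ha, ← hb, hsm, hsm] at hmij
      rw [← ha, ← hb, Subtype.ext hmij]
    rcases hk' with rfl | rfl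
    · exact .inl hxg
    · exact .inr hxg
  have hgij : g i ≠ g j := fun h => hnot (g i) fun l => by
    by_cases hl : l = i
    · rw [h]; exact hg j l (by rw [hl]; exact hij)
    · exact hg i l hl
  rw [Finset.card_eq_two]
  refine ⟨g i, g j, hgij, ?_⟩
  ext x
  simp only [Finset.mem_filter, Finset.mem_univ, true_and, Finset.mem_insert,
    Finset.mem_singleton]
  refine ⟨hPg x, ?_⟩
  rintro (rfl | rfl)
  · exact hgP i j hij hmij
  · exact hgP j i hij.symm hmij.symm

omit [Fintype X] in
/-- Sperner's parity observation: if `A` has as many elements as there are colors, the number of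
facets of `A` carrying exactly the colors other than `i₀` is `1` if `A` carries all colors, and
`0` or `2` otherwise. -/
theorem odd_card_erase_iff (c : X → ι) (i₀ : ι) {A : Finset X} (hA : A.card = Fintype.card ι) :
    Odd (A.filter fun x => (A.erase x).image c = Finset.univ.erase i₀).card ↔
      A.image c = Finset.univ := by
  have hinjerase : ∀ x ∈ A, (A.erase x).image c = Finset.univ.erase i₀ →
      Set.InjOn c (A.erase x : Finset X) := fun x hx h => by
    rw [← Finset.card_image_iff, h, Finset.card_erase_of_mem (Finset.mem_univ _),
      Finset.card_erase_of_mem hx, hA, Finset.card_univ]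
  constructor
  · intro hodd
    by_contra hne
    have hev : Even (A.filter fun x => (A.erase x).image c = Finset.univ.erase i₀).card := by
      rcases (A.filter fun x => (A.erase x).image c = Finset.univ.erase i₀).eq_empty_or_nonempty
        with h0 | ⟨x, hx⟩
      · rw [h0]; simp
      obtain ⟨hxA, hx⟩ := Finset.mem_filter.1 hx
      have hinj := hinjerase x hxA hx
      have hcx : c x ∈ (A.erase x).image c := by
        by_contra hcx
        have : c x = i₀ := by
          rw [hx] at hcx; simpa using hcx
        apply hne
        rw [← Finset.insert_erase hxA, Finset.image_insert, hx, this,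
          Finset.insert_erase (Finset.mem_univ _)]
      obtain ⟨x', hx', hcc⟩ := Finset.mem_image.1 hcx
      have hx'A := Finset.mem_of_mem_erase hx'
      have hxx' : x' ≠ x := Finset.ne_of_mem_erase hx'
      have himg : A.image c = Finset.univ.erase i₀ := by
        rw [← hx]
        nth_rewrite 1 [← Finset.insert_erase hxA]
        rw [Finset.image_insert, Finset.insert_eq_of_mem hcx]
      have : (A.filter fun x => (A.erase x).image c = Finset.univ.erase i₀) = {x, x'} := by
        ext z
        simp only [Finset.mem_filter, Finset.mem_insert, Finset.mem_singleton]
        constructor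
        · rintro ⟨hzA, hz⟩
          by_contra! hcon
          have : c z ∈ (A.erase z).image c := by
            rw [hz, ← himg]; exact Finset.mem_image_of_mem _ hzA
          obtain ⟨w, hw, hwz⟩ := Finset.mem_image.1 this
          have hwA := Finset.mem_of_mem_erase hw
          have hzx : z ∈ A.erase x := Finset.mem_erase.2 ⟨hcon.1, hzA⟩
          by_cases hwx : w = x
          · subst hwx
            exact hcon.2 (hinj hzx hx' (by rw [hcc, hwz]))
          · exact Finset.ne_of_mem_erase hw (hinj (Finset.mem_erase.2 ⟨hwx, hwA⟩) hzx hwz)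
        · rintro (rfl | rfl)
          · exact ⟨hxA, hx⟩
          · refine ⟨hx'A, ?_⟩
            rw [← himg]
            refine (Finset.image_subset_image (Finset.erase_subset _ _)).antisymm ?_
            nth_rewrite 1 [← Finset.insert_erase hx'A]
            rw [Finset.image_insert]
            refine Finset.insert_subset ?_ le_rfl
            rw [hcc]
            exact Finset.mem_image_of_mem _ (Finset.mem_erase.2 ⟨hxx'.symm, hxA⟩)
      rw [this, Finset.card_pair hxx'.symm]
      exact even_two
    exact (Nat.not_even_iff_odd.2 hodd) hev
  · intro h
    have hinj : Set.InjOn c A := by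
      rw [← Finset.card_image_iff, h, hA, Finset.card_univ]
    obtain ⟨x, hxA, hx⟩ := Finset.mem_image.1 (h ▸ Finset.mem_univ i₀)
    have : (A.filter fun x => (A.erase x).image c = Finset.univ.erase i₀) = {x} := by
      ext z
      simp only [Finset.mem_filter, Finset.mem_singleton]
      constructor
      · rintro ⟨hzA, hz⟩
        by_contra hne
        have : i₀ ∈ (A.erase z).image c :=
          Finset.mem_image.2 ⟨x, Finset.mem_erase.2 ⟨Ne.symm hne, hxA⟩, hx⟩
        rw [hz] at this
        simp at this
      · rintro rfl
        refine ⟨hxA, ?_⟩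
        ext j
        simp only [Finset.mem_image, Finset.mem_erase, Finset.mem_univ, and_true]
        constructor
        · rintro ⟨a, ⟨hne, ha⟩, rfl⟩ h'
          exact hne (hinj ha hxA (by rw [hx, h']))
        · intro hj
          obtain ⟨a, ha, rfl⟩ := Finset.mem_image.1 (h ▸ Finset.mem_univ j)
          refine ⟨a, ⟨?_, ha⟩, rfl⟩
          rintro rfl
          exact hj hx
    rw [this, Finset.card_singleton]
    exact odd_one

section slack
variable {u : ι → X → L} {s : ι → X}

/-- The slack elements other than `s i₀` form a set with a unique dominant one-element extension,
by the `u i₀`-largest element that is not a slack element. -/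
theorem card_insert_slack_eq_one (hu : ∀ i, Function.Injective (u i))
    (hbot : ∀ i x, u i (s i) ≤ u i x)
    (htop : ∀ i k x, k ≠ i → x ∉ Set.range s → u i x < u i (s k))
    (hex : ∃ x, x ∉ Set.range s) (i₀ : ι)
    (P : X → Prop) [DecidablePred P] (hP : ∀ x, P x ↔ x ∉ (Finset.univ.erase i₀).image s ∧
      Dominant u (insert x ((Finset.univ.erase i₀).image s))) :
    (Finset.univ.filter P).card = 1 := by
  classical
  obtain ⟨t, ht⟩ := hex
  obtain ⟨x, hx, hxmax⟩ := (Finset.univ.filter fun x => x ∉ Set.range s).exists_max_image (u i₀)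
    ⟨t, by simpa using ht⟩
  replace hx : x ∉ Set.range s := (Finset.mem_filter.1 hx).2
  replace hxmax : ∀ y, y ∉ Set.range s → u i₀ y ≤ u i₀ x :=
    fun y hy => hxmax y (Finset.mem_filter.2 ⟨Finset.mem_univ _, hy⟩)
  have hne : ∀ i y, y ∉ Set.range s → u i (s i) < u i y := fun i y hy =>
    lt_of_le_of_ne (hbot i y) fun h => hy ⟨i, hu i h⟩
  rw [Finset.card_eq_one]
  refine ⟨x, ?_⟩
  ext z
  simp only [Finset.mem_filter, Finset.mem_univ, true_and, Finset.mem_singleton]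
  rw [hP]
  constructor
  · rintro ⟨hz, hdom⟩
    have hkey : ∀ y, y ∉ Set.range s → u i₀ y ≤ u i₀ z := fun y hy => by
      obtain ⟨i, hi⟩ := hdom y
      by_cases h : i = i₀
      · subst h; exact hi z (Finset.mem_insert_self _ _)
      · exact absurd (hi (s i) (Finset.mem_insert_of_mem
          (Finset.mem_image_of_mem _ (by simpa using h)))) (hne i y hy).not_ge
    have hzr : z ∉ Set.range s := by
      rintro ⟨k, rfl⟩
      by_cases h : k = i₀
      · subst h; exact (hne k t ht).not_ge (hkey t ht)
      · exact hz (Finset.mem_image_of_mem _ (by simpa using h))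
    exact hu i₀ (le_antisymm (hxmax z hzr) (hkey x hx))
  · rintro rfl
    refine ⟨fun h => ?_, fun y => ?_⟩
    · obtain ⟨k, -, hk⟩ := Finset.mem_image.1 h
      exact hx ⟨k, hk⟩
    · by_cases hy : y ∈ Set.range s
      · obtain ⟨k, rfl⟩ := hy
        exact ⟨k, fun a _ => hbot k a⟩
      · refine ⟨i₀, fun a ha => ?_⟩
        rcases Finset.mem_insert.1 ha with rfl | ha
        · exact hxmax y hy
        · obtain ⟨k, hk, rfl⟩ := Finset.mem_image.1 ha
          exact (htop i₀ k y (by simpa using hk) hy).le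

/-- Scarf's lemma. The slack element `s i` is the bottom of the order `i` and above all non-slack
elements in the other orders, and has color `i`. Then some dominant set carries all colors. The
proof counts, modulo `2`, the pairs consisting of a dominant set `A` of full size and a facet `B`
of `A` carrying all colors but `i₀`. -/
theorem exists_dominant_image_eq_univ [Nonempty ι] (hu : ∀ i, Function.Injective (u i))
    (hbot : ∀ i x, u i (s i) ≤ u i x)
    (htop : ∀ i k x, k ≠ i → x ∉ Set.range s → u i x < u i (s k))
    (hex : ∃ x, x ∉ Set.range s) (c : X → ι) (hc : ∀ i, c (s i) = i) :
    ∃ A : Finset X, Dominant u A ∧ A.image c = Finset.univ := by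
  classical
  obtain ⟨i₀⟩ := ‹Nonempty ι›
  have hsinj : Function.Injective s := fun i j h => by rw [← hc i, h, hc j]
  set R : Finset (Finset X) :=
    Finset.univ.filter fun A => Dominant u A ∧ A.card = Fintype.card ι with hR
  set E : Finset (Finset X) :=
    Finset.univ.filter fun B => Dominant u B ∧ B.card + 1 = Fintype.card ι ∧
      B.image c = Finset.univ.erase i₀ with hE
  have hcount := Finset.sum_card_bipartiteAbove_eq_sum_card_bipartiteBelow
    (s := E) (t := R) (fun B A => B ⊆ A)
  -- facets of `A` correspond to the removed element
  have hroom : ∀ A ∈ R, (E.bipartiteBelow (fun B A => B ⊆ A) A).card =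
      (A.filter fun x => (A.erase x).image c = Finset.univ.erase i₀).card := fun A hA => by
    obtain ⟨hdom, hcard⟩ := (Finset.mem_filter.1 hA).2
    symm
    refine Finset.card_bij (fun x _ => A.erase x) ?_ ?_ ?_
    · intro x hx
      obtain ⟨hxA, hx⟩ := Finset.mem_filter.1 hx
      refine Finset.mem_filter.2 ⟨Finset.mem_filter.2 ⟨Finset.mem_univ _,
        hdom.mono (Finset.erase_subset _ _), ?_, hx⟩, Finset.erase_subset _ _⟩
      rw [Finset.card_erase_add_one hxA, hcard]
    · intro x hx y hy h
      exact Finset.erase_injOn A (Finset.mem_filter.1 hx).1 (Finset.mem_filter.1 hy).1 h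
    · intro B hB
      obtain ⟨hBE, hBA⟩ := Finset.mem_filter.1 hB
      obtain ⟨-, hBc, hBi⟩ := (Finset.mem_filter.1 hBE).2
      have h1 : (A \ B).card = 1 := by rw [Finset.card_sdiff_of_subset hBA]; omega
      obtain ⟨x, hx⟩ := Finset.card_eq_one.1 h1
      have hxm : x ∈ A \ B := by rw [hx]; simp
      obtain ⟨hxA, hxB⟩ := Finset.mem_sdiff.1 hxm
      have hBe : A.erase x = B := by
        rw [Finset.erase_eq, ← hx, Finset.sdiff_sdiff_eq_self hBA]
      exact ⟨x, Finset.mem_filter.2 ⟨hxA, by rw [hBe, hBi]⟩, hBe⟩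
  -- dominant sets having `B` as a facet correspond to the added element
  have hdoor : ∀ B ∈ E, (R.bipartiteAbove (fun B A => B ⊆ A) B).card =
      (Finset.univ.filter fun x => x ∉ B ∧ Dominant u (insert x B)).card := fun B hB => by
    obtain ⟨hdom, hcard, -⟩ := (Finset.mem_filter.1 hB).2
    symm
    refine Finset.card_bij (fun x _ => insert x B) ?_ ?_ ?_
    · intro x hx
      obtain ⟨-, hxB, hx⟩ := Finset.mem_filter.1 hx
      refine Finset.mem_filter.2 ⟨Finset.mem_filter.2 ⟨Finset.mem_univ _, hx, ?_⟩,
        Finset.subset_insert _ _⟩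
      rw [Finset.card_insert_of_notMem hxB, hcard]
    · intro x hx y hy h
      exact (Finset.insert_inj (Finset.mem_filter.1 hx).2.1).1 h
    · intro A hA
      obtain ⟨hAR, hBA⟩ := Finset.mem_filter.1 hA
      obtain ⟨hAd, hAc⟩ := (Finset.mem_filter.1 hAR).2
      have h1 : (A \ B).card = 1 := by rw [Finset.card_sdiff_of_subset hBA]; omega
      obtain ⟨x, hx⟩ := Finset.card_eq_one.1 h1
      have hxm : x ∈ A \ B := by rw [hx]; simp
      obtain ⟨hxA, hxB⟩ := Finset.mem_sdiff.1 hxm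
      have hins : insert x B = A := by
        rw [Finset.insert_eq, ← hx, Finset.sdiff_union_of_subset hBA]
      exact ⟨x, Finset.mem_filter.2 ⟨Finset.mem_univ _, hxB, by rw [hins]; exact hAd⟩, hins⟩
  set B₀ : Finset X := (Finset.univ.erase i₀).image s with hB₀
  have hone : (Finset.univ.filter fun x => x ∉ B₀ ∧ Dominant u (insert x B₀)).card = 1 :=
    card_insert_slack_eq_one hu hbot htop hex i₀ _ fun x => Iff.rfl
  have hB₀E : B₀ ∈ E := by
    obtain ⟨x, hx⟩ := Finset.card_pos.1 (hone ▸ Nat.one_pos)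
    refine Finset.mem_filter.2 ⟨Finset.mem_univ _,
      (Finset.mem_filter.1 hx).2.2.mono (Finset.subset_insert _ _), ?_, ?_⟩
    · rw [Finset.card_image_of_injective _ hsinj, Finset.card_erase_add_one (Finset.mem_univ _),
        Finset.card_univ]
    · rw [hB₀, Finset.image_image, show c ∘ s = id from funext hc, Finset.image_id]
  -- the only facet made of slack elements alone is `B₀`, so any other one contains a non-slack
  -- element, below which the slack element `s k` never lies in an order `l ≠ k`
  have htwo : ∀ B ∈ E, B ≠ B₀ →
      (Finset.univ.filter fun x => x ∉ B ∧ Dominant u (insert x B)).card = 2 := fun B hB hne => by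
    obtain ⟨hdom, hcard, himg⟩ := (Finset.mem_filter.1 hB).2
    have ht : ∃ t ∈ B, t ∉ Set.range s := by
      by_contra! hcon
      refine hne (Finset.eq_of_subset_of_card_le (fun b hb => ?_) ?_)
      · obtain ⟨k, rfl⟩ := hcon b hb
        refine Finset.mem_image_of_mem _ ?_
        rw [← himg]
        exact Finset.mem_image.2 ⟨_, hb, hc k⟩
      · have := (Finset.mem_filter.1 hB₀E).2.2.1
        omega
    obtain ⟨t, htB, ht⟩ := ht
    exact hdom.card_insert_eq_two hu ⟨t, htB⟩ hcard
      (fun k => ⟨s k, fun l hl => ⟨t, htB, htop l k t hl.symm ht⟩⟩) _ fun x => Iff.rfl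
  have hodd : Odd (∑ B ∈ E, (R.bipartiteAbove (fun B A => B ⊆ A) B).card) := by
    rw [← Finset.add_sum_erase _ _ hB₀E, hdoor B₀ hB₀E, hone]
    refine Odd.add_even odd_one (Finset.even_sum _ fun B hB => ?_)
    rw [hdoor B (Finset.mem_of_mem_erase hB),
      htwo B (Finset.mem_of_mem_erase hB) (Finset.ne_of_mem_erase hB)]
    exact even_two
  rw [hcount] at hodd
  by_contra! hcon
  refine Nat.not_even_iff_odd.2 hodd (Finset.even_sum _ fun A hA => ?_)
  obtain ⟨hdom, hcard⟩ := (Finset.mem_filter.1 hA).2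
  rw [hroom A hA, ← Nat.not_odd_iff_even, odd_card_erase_iff c i₀ hcard]
  exact hcon A hdom

end slack

/-- Scarf's lemma for a finite family of points with real coordinates `w i` and an arbitrary
coloring: there are a set `C` of colors and points `p i` of color `i` for `i ∈ C` such that no
point strictly exceeds in all coordinates `i ∈ C` the minimum of the chosen points. -/
theorem exists_colored_dominant {ι T : Type*} [Finite ι] [Finite T] [Nonempty T]
    (w : ι → T → ℝ) (c : T → ι) :
    ∃ (C : Set ι) (p : ι → T), (∀ i ∈ C, c (p i) = i) ∧
      ∀ y, ∃ i ∈ C, ∀ j ∈ C, w i y ≤ w i (p j) := by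
  classical
  have := Fintype.ofFinite ι
  have := Fintype.ofFinite T
  obtain ⟨t₀⟩ := ‹Nonempty T›
  have : Nonempty ι := ⟨c t₀⟩
  -- slack elements have coordinate `⊥` in their own direction and `⊤` in the others; ties are broken
  -- by an enumeration, which makes all the orders linear
  let e := Fintype.equivFin (T ⊕ ι)
  let v : ι → T ⊕ ι → EReal := fun i =>
    Sum.elim (fun t => (w i t : EReal)) fun k => if k = i then ⊥ else ⊤
  let u : ι → T ⊕ ι → EReal ×ₗ Fin (Fintype.card (T ⊕ ι)) := fun i x => toLex (v i x, e x)
  have hle : ∀ i x y, u i x ≤ u i y → v i x ≤ v i y := fun i x y h => by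
    rcases (Prod.Lex.toLex_le_toLex).1 h with h | h
    · exact h.le
    · exact h.1.le
  have hlt : ∀ i x y, v i x < v i y → u i x < u i y := fun i x y h =>
    Prod.Lex.toLex_lt_toLex.2 (.inl h)
  obtain ⟨A, hA, hcol⟩ := exists_dominant_image_eq_univ (u := u) (s := Sum.inr)
    (fun i x y h => e.injective (congrArg (fun z => (ofLex z).2) h))
    (fun i x => by
      by_cases h : x = Sum.inr i
      · rw [h]
      · refine (hlt _ _ _ ?_).le
        rcases x with t | k
        · simp [v]
        · have : k ≠ i := fun h' => h (by rw [h'])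
          simp [v, this])
    (fun i k x hk hx => by
      rcases x with t | j
      · exact hlt _ _ _ (by simp [v, hk])
      · exact absurd ⟨j, rfl⟩ hx)
    ⟨Sum.inl t₀, by simp⟩ (Sum.elim c id) (fun i => rfl)
  have hp : ∀ i, ∃ t, Sum.inr i ∉ A → Sum.inl t ∈ A ∧ c t = i := fun i => by
    obtain ⟨x, hx, hxi⟩ := Finset.mem_image.1 (hcol ▸ Finset.mem_univ i)
    rcases x with t | k
    · exact ⟨t, fun _ => ⟨hx, hxi⟩⟩
    · obtain rfl : k = i := hxi
      exact ⟨t₀, fun h => absurd hx h⟩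
  choose p hp using hp
  refine ⟨{i | Sum.inr i ∉ A}, p, fun i hi => (hp i hi).2, fun y => ?_⟩
  obtain ⟨i, hi⟩ := hA (Sum.inl y)
  refine ⟨i, fun h => ?_, fun j hj => ?_⟩
  · have := hle _ _ _ (hi _ h)
    simp [v] at this
  · have := hle _ _ _ (hi _ (hp j hj).1)
    simpa [v] using this

end Scarf

/-! ### Brouwer's theorem on the standard simplex -/

/-- For any coloring of the simplex and any `ε > 0` there are a nonempty set `C` of colors and points
`p j` of color `j ∈ C` that are `ε`-close to one another and have coordinates at most `ε`
outside `C`. -/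
theorem exists_close_colored_points {ι : Type*} [Fintype ι] [Nonempty ι]
    (c : (ι → ℝ) → ι) {ε : ℝ} (hε : 0 < ε) :
    ∃ (C : Set ι) (p : ι → ι → ℝ), C.Nonempty ∧ (∀ j, p j ∈ stdSimplex ℝ ι) ∧
      (∀ j ∈ C, c (p j) = j) ∧ (∀ j ∈ C, ∀ k ∈ C, ∀ i, p j i ≤ p k i + ε) ∧
      ∀ j ∈ C, ∀ i ∉ C, p j i ≤ ε := by
  classical
  have hN : (0 : ℝ) < Fintype.card ι := by exact_mod_cast Fintype.card_pos
  set δ : ℝ := ε / Fintype.card ι with hδ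
  have hδ0 : 0 < δ := div_pos hε hN
  obtain ⟨T, hTs, hTfin, hTcov⟩ := (isCompact_stdSimplex ℝ ι).finite_cover_balls hδ0
  have hnet : ∀ z ∈ stdSimplex ℝ ι, ∃ y : T, ∀ i, z i < y.1 i + δ := fun z hz => by
    obtain ⟨y, hy, hzy⟩ := Set.mem_iUnion₂.1 (hTcov hz)
    refine ⟨⟨y, hy⟩, fun i => ?_⟩
    have h1 := (dist_le_pi_dist z y i).trans_lt (Metric.mem_ball.1 hzy)
    rw [Real.dist_eq] at h1
    linarith [(abs_lt.1 h1).2]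
  have : Finite T := hTfin
  obtain ⟨z₀, hz₀⟩ : (stdSimplex ℝ ι).Nonempty :=
    ⟨_, single_mem_stdSimplex ℝ (Classical.arbitrary ι)⟩
  have : Nonempty T := ⟨(hnet z₀ hz₀).choose⟩
  obtain ⟨C, p, hcol, hdom⟩ := Scarf.exists_colored_dominant (fun i (t : T) => t.1 i) fun t => c t.1
  have hpΔ : ∀ j, (p j).1 ∈ stdSimplex ℝ ι := fun j => hTs (p j).2
  have hCne : C.Nonempty := by
    obtain ⟨i, hi, -⟩ := hdom (Classical.arbitrary T)
    exact ⟨i, hi⟩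
  set F : Finset ι := Finset.univ.filter (· ∈ C) with hF
  have hFC : ∀ i, i ∈ F ↔ i ∈ C := fun i => by simp [hF]
  have hFne : F.Nonempty := by
    obtain ⟨i, hi⟩ := hCne
    exact ⟨i, (hFC i).2 hi⟩
  choose q hqF hq using fun i => F.exists_min_image (fun j => (p j).1 i) hFne
  set m : ι → ℝ := fun i => (p (q i)).1 i with hm
  have hm0 : ∀ i, 0 ≤ m i := fun i => (hpΔ _).1 i
  have hFcard : (0 : ℝ) < F.card := by exact_mod_cast hFne.card_pos
  -- otherwise the point with coordinates `m i + r` on `C` and `0` elsewhere lies in the simplex, and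
  -- a point of the net near it exceeds `m` in all coordinates of `C`
  have hsum : 1 - ε ≤ ∑ i ∈ F, m i := by
    by_contra! hlt
    set r : ℝ := (1 - ∑ i ∈ F, m i) / F.card with hr
    have hrδ : δ < r := by
      rw [hδ, hr, div_lt_div_iff₀ hN hFcard]
      have h1 : (F.card : ℝ) ≤ Fintype.card ι := by exact_mod_cast Finset.card_le_univ F
      nlinarith
    have hz : (fun i => if i ∈ F then m i + r else 0) ∈ stdSimplex ℝ ι := by
      refine ⟨fun i => ?_, ?_⟩
      · dsimp only
        split_ifs
        · linarith [hm0 i]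
        · exact le_rfl
      · rw [Finset.sum_ite_mem, Finset.univ_inter, Finset.sum_add_distrib, Finset.sum_const,
          nsmul_eq_mul, hr, mul_div_cancel₀ _ hFcard.ne']
        ring
    obtain ⟨y, hy⟩ := hnet _ hz
    obtain ⟨i, hi, hyi⟩ := hdom y
    have h1 := hy i
    rw [if_pos ((hFC i).2 hi)] at h1
    have h2 : y.1 i ≤ m i := hyi (q i) ((hFC _).1 (hqF i))
    linarith
  -- the coordinates of `p j` sum to `1` and exceed `m` on `C`, so the total excess is at most `ε`
  have hupper : ∀ j ∈ C, ∀ i ∈ F, (p j).1 i ≤ m i + ε := fun j hj i hi => by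
    have h1 : ∀ l ∈ F, 0 ≤ (p j).1 l - m l := fun l _ => sub_nonneg.2 (hq l j ((hFC j).2 hj))
    have h2 := Finset.single_le_sum h1 hi
    rw [Finset.sum_sub_distrib] at h2
    have h3 : ∑ l ∈ F, (p j).1 l ≤ 1 := by
      rw [← (hpΔ j).2]
      exact Finset.sum_le_univ_sum_of_nonneg (hpΔ j).1
    linarith
  have hout : ∀ j ∈ C, ∀ i ∉ C, (p j).1 i ≤ ε := fun j hj i hi => by
    have h1 : ∑ l ∈ F, m l ≤ ∑ l ∈ F, (p j).1 l :=
      Finset.sum_le_sum fun l _ => hq l j ((hFC j).2 hj)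
    have h2 : ∑ l ∈ insert i F, (p j).1 l ≤ 1 := by
      rw [← (hpΔ j).2]
      exact Finset.sum_le_univ_sum_of_nonneg (hpΔ j).1
    rw [Finset.sum_insert fun h => hi ((hFC i).1 h)] at h2
    linarith
  refine ⟨C, fun j => (p j).1, hCne, hpΔ, hcol, fun j hj k hk i => ?_, hout⟩
  by_cases hi : i ∈ C
  · have h1 := hupper j hj i ((hFC i).2 hi)
    have h2 : m i ≤ (p k).1 i := hq i k ((hFC k).2 hk)
    dsimp only
    linarith
  · have h1 := hout j hj i hi
    have h2 := (hpΔ k).1 i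
    dsimp only
    linarith

/-- **Brouwer's fixed point theorem** for the standard simplex. -/
theorem exists_fixedPoint_stdSimplex {ι : Type*} [Fintype ι] [Nonempty ι]
    {f : (ι → ℝ) → ι → ℝ} (hf : ContinuousOn f (stdSimplex ℝ ι))
    (hmaps : Set.MapsTo f (stdSimplex ℝ ι) (stdSimplex ℝ ι)) :
    ∃ x ∈ stdSimplex ℝ ι, f x = x := by
  classical
  -- a point `x` may be given the color `i` if `x i ≤ f x i`; such an `i` exists since both `x` and
  -- `f x` have coordinate sum `1`
  have hcolor : ∀ x, ∃ i, x ∈ stdSimplex ℝ ι → x i ≤ f x i := fun x => by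
    by_contra! hcon
    have hx := (hcon (Classical.arbitrary ι)).1
    have : ∑ i, f x i < ∑ i, x i :=
      Finset.sum_lt_sum_of_nonempty Finset.univ_nonempty fun i _ => (hcon i).2
    rw [hx.2, (hmaps hx).2] at this
    exact lt_irrefl _ this
  choose c hc using hcolor
  have happrox : ∀ κ : ℝ, 0 < κ → ∃ x ∈ stdSimplex ℝ ι, ∀ i, x i - κ ≤ f x i := fun κ hκ => by
    obtain ⟨δ, hδ, hunif⟩ := Metric.uniformContinuousOn_iff.1
      ((isCompact_stdSimplex ℝ ι).uniformContinuousOn_of_continuous hf) (κ / 2) (half_pos hκ)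
    set ε := min (δ / 2) (κ / 2) with hε
    have hε0 : 0 < ε := lt_min (half_pos hδ) (half_pos hκ)
    obtain ⟨C, p, ⟨j, hj⟩, hpΔ, hcol, hclose, hout⟩ := exists_close_colored_points c hε0
    refine ⟨p j, hpΔ j, fun i => ?_⟩
    by_cases hi : i ∈ C
    · have h1 : p i i ≤ f (p i) i := by
        have := hc (p i) (hpΔ i)
        rwa [hcol i hi] at this
      have hdist : dist (p i) (p j) < δ := by
        refine ((dist_pi_le_iff hε0.le).2 fun l => ?_).trans_lt
          ((min_le_left _ _).trans_lt (half_lt_self hδ))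
        rw [Real.dist_eq, abs_le]
        constructor <;> linarith [hclose i hi j hj l, hclose j hj i hi l]
      have h2 := (dist_le_pi_dist _ _ i).trans_lt (hunif _ (hpΔ i) _ (hpΔ j) hdist)
      rw [Real.dist_eq] at h2
      have h3 := (abs_lt.1 h2).2
      have h4 := hclose j hj i hi i
      have h5 : ε ≤ κ / 2 := min_le_right _ _
      linarith
    · have h1 := hout j hj i hi
      have h2 := (hmaps (hpΔ j)).1 i
      have h5 : ε ≤ κ / 2 := min_le_right _ _
      linarith
  -- a limit point `a` satisfies `a i ≤ f a i` for all `i`, with equality since the sums agree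
  choose x hxΔ hx using fun n : ℕ => happrox (1 / ((n : ℝ) + 1)) Nat.one_div_pos_of_nat
  obtain ⟨a, ha, φ, hφ, hlim⟩ := (isCompact_stdSimplex ℝ ι).tendsto_subseq hxΔ
  have hflim : Filter.Tendsto (fun n => f (x (φ n))) Filter.atTop (nhds (f a)) :=
    (hf a ha).tendsto.comp (tendsto_nhdsWithin_iff.2 ⟨hlim, .of_forall fun n => hxΔ _⟩)
  have hle : ∀ i, a i ≤ f a i := fun i => by
    have h1 : Filter.Tendsto (fun n => x (φ n) i - 1 / ((φ n : ℝ) + 1)) Filter.atTop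
        (nhds (a i - 0)) :=
      ((tendsto_pi_nhds.1 hlim i)).sub
        (tendsto_one_div_add_atTop_nhds_zero_nat.comp hφ.tendsto_atTop)
    rw [sub_zero] at h1
    exact le_of_tendsto_of_tendsto' h1 (tendsto_pi_nhds.1 hflim i) fun n => hx (φ n) i
  refine ⟨a, ha, ?_⟩
  have hsum : ∑ i, a i = ∑ i, f a i := by rw [ha.2, (hmaps ha).2]
  funext i
  exact ((Finset.sum_eq_sum_iff_of_le fun i _ => hle i).1 hsum i (Finset.mem_univ i)).symm

/-! ### Stationary points of symmetric incentives -/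

/-- There is a continuous retraction onto the `τ`-invariant functions that preserves the simplex,
namely averaging over the powers of `τ`. -/
theorem exists_invariant_average {S : Type*} [Fintype S] (τ : Equiv.Perm S) :
    ∃ A : (S → ℝ) → S → ℝ, Continuous A ∧ (∀ y ∈ stdSimplex ℝ S, A y ∈ stdSimplex ℝ S) ∧
      (∀ y α, A y (τ α) = A y α) ∧ ∀ y, (∀ α, y (τ α) = y α) → A y = y := by
  classical
  have hN : (0 : ℝ) < Fintype.card (Subgroup.zpowers τ) := by exact_mod_cast Fintype.card_pos
  refine ⟨fun y α => (∑ g : Subgroup.zpowers τ, y (g.1 α)) / Fintype.card (Subgroup.zpowers τ),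
    by fun_prop, fun y hy => ⟨fun α => ?_, ?_⟩, fun y α => ?_, fun y hy => ?_⟩
  · exact div_nonneg (Finset.sum_nonneg fun g _ => hy.1 _) hN.le
  · rw [← Finset.sum_div, Finset.sum_comm]
    simp_rw [Equiv.sum_comp _ y, hy.2]
    rw [Finset.sum_const, nsmul_eq_mul, mul_one, Finset.card_univ, div_self hN.ne']
  · exact congrArg (· / (Fintype.card (Subgroup.zpowers τ) : ℝ)) (Equiv.sum_comp (Equiv.mulRight
      (⟨τ, Subgroup.mem_zpowers τ⟩ : Subgroup.zpowers τ)) fun g => y (g.1 α))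
  · have hinv : ∀ g : Subgroup.zpowers τ, ∀ α, y (g.1 α) = y α := by
      rintro ⟨g, hg⟩
      obtain ⟨k, rfl⟩ := mem_powers_iff_mem_zpowers.2 hg
      induction k with
      | zero => intro α; rfl
      | succ k ih =>
        intro α
        simp only [pow_succ', Equiv.Perm.mul_apply, hy]
        exact ih ⟨k, by simp⟩ α
    funext α
    simp only [hinv, Finset.sum_const, nsmul_eq_mul, Finset.card_univ]
    rw [mul_div_cancel_left₀ _ hN.ne']

/-- If `ψ` is continuous and `τ`-invariant on the `τ`-invariant mixed strategies, and nonnegative on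
the strategies that are not played, then `ψ y` is proportional to `y` for some `τ`-invariant mixed
strategy `y`. -/
theorem exists_invariant_proportional {S : Type*} [Fintype S] [Nonempty S] (τ : Equiv.Perm S)
    {ψ : (S → ℝ) → S → ℝ}
    (hψ : ContinuousOn ψ {y | y ∈ stdSimplex ℝ S ∧ ∀ α, y (τ α) = y α})
    (hnonneg : ∀ y ∈ stdSimplex ℝ S, (∀ α, y (τ α) = y α) → ∀ α, y α = 0 → 0 ≤ ψ y α)
    (hinv : ∀ y ∈ stdSimplex ℝ S, (∀ α, y (τ α) = y α) → ∀ α, ψ y (τ α) = ψ y α) :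
    ∃ y ∈ stdSimplex ℝ S, (∀ α, y (τ α) = y α) ∧ ∀ α, ψ y α = y α * ∑ β, ψ y β := by
  obtain ⟨A, hAcont, hAmaps, hAinv, hAid⟩ := exists_invariant_average τ
  -- `v` is tangent to the simplex and points inwards at the boundary; its zeros are sought
  set v : (S → ℝ) → S → ℝ := fun y α => ψ y α - y α * ∑ β, ψ y β with hv
  have hden : ∀ y, (0 : ℝ) < 1 + ∑ β, max (v y β) 0 := fun y => by
    have := Finset.sum_nonneg fun β (_ : β ∈ Finset.univ) => le_max_right (v y β) 0
    linarith
  -- the positive part of `v` is used because `y + v y` itself may leave the simplex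
  set G : (S → ℝ) → S → ℝ := fun y α => (y α + max (v y α) 0) / (1 + ∑ β, max (v y β) 0) with hG
  have hvcont : ∀ α, ContinuousOn (fun y => v y α)
      {y | y ∈ stdSimplex ℝ S ∧ ∀ α, y (τ α) = y α} := fun α => by
    have h := continuousOn_pi.1 hψ
    exact (h α).sub ((continuous_apply α).continuousOn.mul (continuousOn_finsetSum _ fun β _ => h β))
  have hmaxcont : ∀ α, ContinuousOn (fun y => max (v y α) 0)
      {y | y ∈ stdSimplex ℝ S ∧ ∀ α, y (τ α) = y α} := fun α =>
    (continuous_id.max continuous_const).comp_continuousOn (hvcont α)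
  have hGcont : ContinuousOn G {y | y ∈ stdSimplex ℝ S ∧ ∀ α, y (τ α) = y α} :=
    continuousOn_pi.2 fun α =>
      ((continuous_apply α).continuousOn.add (hmaxcont α)).div
        (continuousOn_const.add (continuousOn_finsetSum _ fun β _ =>
          hmaxcont β)) fun y _ => (hden y).ne'
  have hGmaps : ∀ y ∈ stdSimplex ℝ S, G y ∈ stdSimplex ℝ S := fun y hy => by
    refine ⟨fun α => div_nonneg (add_nonneg (hy.1 α) (le_max_right _ _)) (hden y).le, ?_⟩
    rw [← Finset.sum_div, Finset.sum_add_distrib, hy.2, div_self (hden y).ne']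
  obtain ⟨y, hy, hfix⟩ := exists_fixedPoint_stdSimplex (f := fun y => G (A y))
    (hGcont.comp hAcont.continuousOn fun y hy => ⟨hAmaps y hy, hAinv y⟩)
    (fun y hy => hGmaps _ (hAmaps y hy))
  have hyinv : ∀ α, y (τ α) = y α := fun α => by
    have h1 := hinv _ (hAmaps y hy) (hAinv y) α
    rw [← hfix]
    simp only [hG, hv, hAinv, h1]
  simp only [hAid y hyinv] at hfix
  refine ⟨y, hy, hyinv, ?_⟩
  have hvsum : ∑ α, v y α = 0 := by
    simp only [hv]
    rw [Finset.sum_sub_distrib, ← Finset.sum_mul, hy.2, one_mul, sub_self]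
  set s := ∑ β, max (v y β) 0 with hs
  have hmax : ∀ α, max (v y α) 0 = y α * s := fun α => by
    have h := congrFun hfix α
    simp only [hG] at h
    rw [div_eq_iff (hden y).ne'] at h
    linarith
  -- if `s > 0` then `v y` is nonnegative everywhere, so its sum `0` equals `s`
  have hs0 : s = 0 := by
    by_contra hne
    have hspos : 0 < s := lt_of_le_of_ne
      (Finset.sum_nonneg fun β _ => le_max_right (v y β) 0) (Ne.symm hne)
    have hvnonneg : ∀ α, 0 ≤ v y α := fun α => by
      rcases (hy.1 α).eq_or_lt with h0 | hpos
      · simp only [hv, ← h0, zero_mul, sub_zero]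
        exact hnonneg y hy hyinv α h0.symm
      · by_contra! hneg
        have := hmax α
        rw [max_eq_right hneg.le] at this
        exact (mul_pos hpos hspos).ne this
    exact hne ((Finset.sum_congr rfl fun α _ => max_eq_left (hvnonneg α)).trans hvsum)
  have hvle : ∀ α, v y α ≤ 0 := fun α => by
    have := hmax α
    rw [hs0, mul_zero] at this
    exact max_eq_right_iff.1 this
  have hv0 := (Finset.sum_eq_zero_iff_of_nonpos fun α _ => hvle α).1 hvsum
  exact fun α => sub_eq_zero.1 (hv0 α (Finset.mem_univ α))

theorem equilibriumEquation_of_proportional {ι : Type*} {S : ι → Type*} [∀ i, Fintype (S i)]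
    {φ : ((i : ι) → S i → ℝ) → ((i : ι) → S i → ℝ)} {x : (i : ι) → S i → ℝ} {i : ι}
    (hx : x i ∈ stdSimplex ℝ (S i)) (hprop : ∀ α, φ x i α = x i α * ∑ β, φ x i β)
    (h : 0 ≤ ∑ β, φ x i β ∨ ∀ α, x i α ≠ 0) :
    IncentiveGame.EquilibriumEquation φ x i := by
  set s := ∑ β, φ x i β with hs
  have hquot : ∀ α, x i α ≠ 0 → φ x i α / x i α = s := fun α hα => by
    rw [hprop α, mul_div_cancel_left₀ _ hα]
  -- at `x i α = 0` the quotient is `0`, which is at most `s` by the first alternative in `h`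
  have hle : ∀ α, φ x i α / x i α ≤ s := fun α => by
    by_cases hα : x i α = 0
    · rw [hα, div_zero]
      exact h.resolve_right fun h' => h' α hα
    · exact (hquot α hα).le
  have hval : ∑ α, x i α * (φ x i α / x i α) = s := by
    rw [hs]
    refine Finset.sum_congr rfl fun α _ => ?_
    by_cases hα : x i α = 0
    · rw [hprop α, hα, zero_mul, zero_mul]
    · rw [mul_div_cancel₀ _ hα]
  refine ⟨fun α hα => by rw [hprop α, hα, zero_mul], ⟨x i, hx, rfl⟩, ?_⟩
  rintro _ ⟨y, hy, rfl⟩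
  rw [hval]
  calc ∑ α, y α * (φ x i α / x i α) ≤ ∑ α, y α * s :=
        Finset.sum_le_sum fun α _ => mul_le_mul_of_nonneg_left (hle α) (hy.1 α)
    _ = s := by rw [← Finset.sum_mul, hy.2, one_mul]

/-! ### Symmetric incentive equilibria -/

theorem mainTheorem2 {n : ℕ} [NeZero n] {S₁ : Type*} [Fintype S₁] [Nonempty S₁]
    (σ : Fin n → Equiv.Perm S₁)
    (D : Set (Fin n → S₁ → ℝ)) (hD : IncentiveGame.profiles (fun _ : Fin n => S₁) ⊆ D)
    (φ : (Fin n → S₁ → ℝ) → (Fin n → S₁ → ℝ))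
    (hφ : IncentiveGame.IsIncentiveOn (S := fun _ : Fin n => S₁) D φ)
    (hcont : ContinuousOn φ D)
    (hsymm : ∀ x ∈ IncentiveGame.symmetricProfiles σ, ∀ i α, φ x 0 (σ i α) = φ x i α) :
    ∃ x ∈ IncentiveGame.symmetricProfiles σ,
      IncentiveGame.update (S := fun _ : Fin n => S₁) φ x = x ∧
      ∀ i, (0 ≤ ∑ β, φ x i β ∨ ∀ α, x i α ≠ 0) →
        IncentiveGame.EquilibriumEquation (S := fun _ : Fin n => S₁) φ x i := by
  -- a symmetric profile is determined by the strategy `y` of the first player, which is `σ 0`-invariant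
  set e : (S₁ → ℝ) → Fin n → S₁ → ℝ := fun y i α => y (σ i α) with he
  have heU : ∀ y ∈ stdSimplex ℝ S₁, (∀ α, y (σ 0 α) = y α) →
      e y ∈ IncentiveGame.symmetricProfiles σ := fun y hy hinv =>
    ⟨fun i => ⟨fun α => hy.1 _, by rw [← hy.2]; exact Equiv.sum_comp (σ i) y⟩, fun i α => hinv _⟩
  have heD : ∀ y ∈ stdSimplex ℝ S₁, (∀ α, y (σ 0 α) = y α) → e y ∈ D := fun y hy hinv =>
    hD (heU y hy hinv).1
  have hecont : Continuous e := by fun_prop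
  obtain ⟨y, hy, hinv, hprop⟩ := exists_invariant_proportional (σ 0) (ψ := fun y => φ (e y) 0)
    ((continuous_apply 0).comp_continuousOn
      (hcont.comp hecont.continuousOn fun y hy => heD y hy.1 hy.2))
    (fun y hy hinv α hα => hφ.nonneg_of_eq_zero _ (heD y hy hinv) 0 α (by rw [← hα]; exact hinv α))
    (fun y hy hinv α => hsymm _ (heU y hy hinv) 0 α)
  have hU := heU y hy hinv
  have hsum : ∀ i, ∑ β, φ (e y) i β = ∑ β, φ (e y) 0 β := fun i => by
    rw [← Equiv.sum_comp (σ i) (φ (e y) 0)]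
    exact Finset.sum_congr rfl fun α _ => (hsymm _ hU i α).symm
  have hprop' : ∀ i α, φ (e y) i α = e y i α * ∑ β, φ (e y) i β := fun i α => by
    rw [hsum, ← hsymm _ hU i α]
    exact hprop (σ i α)
  refine ⟨e y, hU, ?_, fun i h => equilibriumEquation_of_proportional (hU.1 i) (hprop' i) h⟩
  funext i α
  have hne : 1 + ∑ β, φ (e y) i β ≠ 0 := fun h =>
    hφ.sum_ne_neg_one _ (heD y hy hinv) i (by linarith)
  rw [IncentiveGame.update, div_eq_iff hne, mul_add, mul_one]
  exact congrArg _ (hprop' i α)
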